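/- **Setting.** Consider $\mathbf x[k+1]=A\mathbf x[k]+Bu[k]+G\mathbf w[k]$, $k=0,\dots,N-1$, with deterministic $\mathbf x[0]=x_0\in\mathbb R^n$, inputs in $\mathbb R^m$ and disturbances in $\mathbb R^p$. Stacking over time, write $\overline{\mathbf x}=\overline A x_0+\overline B\,\overline u+\overline G\,\overline{\mathbf w}$ with $\overline{\mathbf x}\in\mathbb R^{n(N+1)}$, $\overline u\in\mathbb R^{mN}$, $\overline{\mathbf w}\in\mathbb R^{pN}$. Let $\mathcal S=\{x: p_i^\top x\le q_i,\ i=1,\dots,l\}$ be a polyhedron in $\mathbb R^{n(N+1)}$, let $\mathcal U=[u_{\min},u_{\max}]\subset\mathbb R^m$ be a box and let $\Delta\in[0,1]$. An input $\overline u$ is *feasible for the chance-constrained problem* if $\overline u\in\mathcal U^N$ and $\mathbb P\{\overline{\mathbf x}\notin\mathcal S\}\le\Delta$. Let $\mathbf w_1,\mathbf w_2,\dots$ be i.i.d. samples with the law of $\overline{\mathbf w}$. For each sample size $N_s$ let $\overline\Sigma=\overline\Sigma_{N_s}$ be a symmetric positive semidefinite smoothing matrix (it may depend on $N_s$ and on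 the data), and put $$\hat\varphi_{\overline{\mathbf w}}(t)=\frac1{N_s}\sum_{j=1}^{N_s}e^{i t^\top\mathbf w_j}e^{-\frac12t^\top\overline\Sigma t}\quad(t\in\mathbb R^{pN}),\qquad \hat\varphi_{y_i}(s)=\frac1{N_s}\sum_{j=1}^{N_s}e^{i s\,p_i^\top\overline G\mathbf w_j}e^{-\frac12 s^2\,p_i^\top\overline G\,\overline\Sigma\,\overline G^\top p_i}\quad(s\in\mathbb R).$$ Let $\Phi_i$ be the CDF of $y_i=p_i^\top\overline G\,\overline{\mathbf w}$, and let $$\hat\Phi_i(x)=\tfrac12-\tfrac1\pi\int_0^\infty\operatorname{Im}\big(e^{-isx}\hat\varphi_{y_i}(s)/s\big)\,ds$$ (an improper integral) be the approximate CDF. The approximate $d$-th moment of the $k$-th coordinate of $\overline{\mathbf w}$ is $(-i)^d\,\partial^d\hat\varphi_{\overline{\mathbf w}}/\partial t_k^d$ at $t=0$. Let $\varepsilon$ be a fixed real number. For each $N_s\ge1$, each realization of the data and each $i$, let $\hat\Phi_i^l(x)=\min_{1\le r\le z^i}(a_{i,r}x+c_{i,r})$, with $z^i\ge1$, be a piecewise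 affine function such that $0\le\hat\Phi_i-\hat\Phi_i^l\le\varepsilon$ on $[x_i^{lb},\infty)$; the numbers $z^i,a_{i,r},c_{i,r},x_i^{lb}$ may depend on $N_s$ and on the data. A pair $(\overline u,\overline\delta)\in\mathbb R^{mN}\times\mathbb R^l$ is *feasible for the convex program* (with $N_s$ samples) if, for all $i$ and $r$, $$a_{i,r}\big(q_i-p_i^\top(\overline Ax_0+\overline B\,\overline u)\big)+c_{i,r}\ge1-\delta_i,\qquad q_i-p_i^\top(\overline Ax_0+\overline B\,\overline u)\ge x_i^{lb},$$ and $\sum_i\delta_i\le\Delta$, $\delta_i\ge0$, $\overline u\in\mathcal U^N$. **Theorem.** Suppose that $\hat\varphi_{\overline{\mathbf w}}(t)$ converges in probability to the characteristic function $\varphi_{\overline{\mathbf w}}(t)$ of $\overline{\mathbf w}$ as $N_s\to\infty$, for every $t\in\mathbb R^{pN}$. Then, as $N_s\to\infty$: 1. For every $i$, $\hat\Phi_i(x)\to\Phi_i(x)$ in probability at every continuity point $x$ of $\Phi_i$. 2. For $d=1,2$ and every coordinate $k$ with $\mathbb E|\overline{\mathbf w}_k|^d<\infty$, the approximate $d$-th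 moment of $\overline{\mathbf w}_k$ converges in probability to $\mathbb E[\overline{\mathbf w}_k^d]$. 3. Feasible solutions of the convex program are asymptotically feasible for the chance-constrained problem: (a) if for a fixed $\overline u$ the probability that $(\overline u,\overline\delta)$ is feasible for the convex program for some $\overline\delta$ does not tend to $0$, then $\overline u$ is feasible for the chance-constrained problem; (b) for every $\eta>0$, the probability that the convex program has a feasible pair $(\overline u,\overline\delta)$ whose $\overline u$ is not within distance less than $\eta$ of any input that is feasible for the chance-constrained problem tends to $0$ (so, if the latter has no feasible input, the probability that the convex program is feasible tends to $0$). Probabilities of events that need not be measurable are outer probabilities. -/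

import Mathlib

open MeasureTheory ProbabilityTheory Filter Topology
open scoped Matrix

noncomputable section

/-! ### Linear dynamics in concatenated form -/

/-- Data of the chance-constrained open-loop control problem over a horizon of `N` steps, for the
system `x[k+1] = A x[k] + B u[k] + G w[k]`, `x[0] = x₀`: the system matrices, the polytope
`S = {x : P x ≤ q}` (with `l` rows) of admissible concatenated states, the input box
`[uMin, uMax]` and the violation threshold `Δ`.  Concatenated states, inputs and disturbances are
indexed by pairs (time, coordinate).  The cost plays no role for feasibility and is left out. -/
structure ControlData (n m p l N : ℕ) where
  A : Matrix (Fin n) (Fin n) ℝ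
  B : Matrix (Fin n) (Fin m) ℝ
  G : Matrix (Fin n) (Fin p) ℝ
  x₀ : Fin n → ℝ
  P : Matrix (Fin l) (Fin (N + 1) × Fin n) ℝ
  q : Fin l → ℝ
  uMin : Fin m → ℝ
  uMax : Fin m → ℝ
  Δ : ℝ

/-- Block column with blocks `A ^ k`, `k = 0, …, N`. -/
def concatA {n : ℕ} (N : ℕ) (A : Matrix (Fin n) (Fin n) ℝ) :
    Matrix (Fin (N + 1) × Fin n) (Fin n) ℝ :=
  fun r b => (A ^ (r.1 : ℕ)) r.2 b

/-- Block matrix whose `(k, j)` block is `A ^ (k - 1 - j) * M` for `j < k`, and `0` otherwise. -/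
def concatM {n d : ℕ} (N : ℕ) (A : Matrix (Fin n) (Fin n) ℝ) (M : Matrix (Fin n) (Fin d) ℝ) :
    Matrix (Fin (N + 1) × Fin n) (Fin N × Fin d) ℝ :=
  fun r c => if (c.1 : ℕ) < (r.1 : ℕ)
    then (A ^ ((r.1 : ℕ) - 1 - (c.1 : ℕ)) * M) r.2 c.2 else 0

namespace ControlData

variable {n m p l N : ℕ}

/-- Concatenated state reached under the input `u` and the disturbance `w`. -/
def state (D : ControlData n m p l N) (u : Fin N × Fin m → ℝ) (w : Fin N × Fin p → ℝ) :
    Fin (N + 1) × Fin n → ℝ :=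
  concatA N D.A *ᵥ D.x₀ + concatM N D.A D.B *ᵥ u + concatM N D.A D.G *ᵥ w

/-- The polytope `S`. -/
def safeSet (D : ControlData n m p l N) : Set (Fin (N + 1) × Fin n → ℝ) :=
  {x | D.P *ᵥ x ≤ D.q}

/-- The set of admissible concatenated inputs: each `u[k]` lies in the box `[uMin, uMax]`. -/
def inputSet (D : ControlData n m p l N) : Set (Fin N × Fin m → ℝ) :=
  {u | ∀ k, (fun j => u (k, j)) ∈ Set.Icc D.uMin D.uMax}

/-- The row vector `pᵢᵀ Ḡ`. -/
def row (D : ControlData n m p l N) (i : Fin l) : Fin N × Fin p → ℝ :=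
  D.P i ᵥ* concatM N D.A D.G

/-- The margin `qᵢ - pᵢᵀ (Ā x₀ + B̄ u)`. -/
def margin (D : ControlData n m p l N) (i : Fin l) (u : Fin N × Fin m → ℝ) : ℝ :=
  D.q i - D.P i ⬝ᵥ (concatA N D.A *ᵥ D.x₀ + concatM N D.A D.B *ᵥ u)

/-- Feasible inputs of the original problem: `Prob(x ∉ S) ≤ Δ` and `u` is admissible. -/
def feasible (D : ControlData n m p l N) {Ω : Type*} [MeasurableSpace Ω] (μ : Measure Ω)
    (wbar : Ω → Fin N × Fin p → ℝ) : Set (Fin N × Fin m → ℝ) :=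
  {u | μ {ω | D.state u (wbar ω) ∉ D.safeSet} ≤ ENNReal.ofReal D.Δ ∧ u ∈ D.inputSet}

end ControlData

/-! ### Empirical characteristic function, approximate CDF, approximate moments -/

/-- Smoothed empirical characteristic function of the observations `w j`, with weights `α j` and
smoothing matrix `Sig`. -/
def ecf {κ ι : Type*} [Fintype κ] [Fintype ι] (α : κ → ℝ) (Sig : Matrix ι ι ℝ)
    (w : κ → ι → ℝ) (t : ι → ℝ) : ℂ :=
  ∑ j, (α j : ℂ) * (Complex.exp (Complex.I * ((t ⬝ᵥ w j : ℝ) : ℂ)) *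
    Complex.exp (((-(1 / 2) * (t ⬝ᵥ (Sig *ᵥ t)) : ℝ) : ℂ)))

/-- Smoothed empirical characteristic function of the scalar `v ⬝ᵥ w`. -/
def ecfScalar {κ ι : Type*} [Fintype κ] [Fintype ι] (α : κ → ℝ) (Sig : Matrix ι ι ℝ)
    (w : κ → ι → ℝ) (v : ι → ℝ) (t : ℝ) : ℂ :=
  ∑ j, (α j : ℂ) * (Complex.exp (Complex.I * ((t * (v ⬝ᵥ w j) : ℝ) : ℂ)) *
    Complex.exp (((-(1 / 2) * ((v ⬝ᵥ (Sig *ᵥ v)) * t ^ 2) : ℝ) : ℂ)))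

/-- Gil-Pelaez inversion
`x ↦ 1/2 - (1/π) ∫₀^∞ Im (exp (-i t x) φ(t) / t) dt`, the integral being an improper one. -/
def gilPelaez (φ : ℝ → ℂ) (x : ℝ) : ℝ :=
  1 / 2 - 1 / Real.pi * limUnder atTop (fun T : ℝ =>
    ∫ t in (0 : ℝ)..T, (Complex.exp (-(Complex.I * (t : ℂ) * (x : ℂ))) * φ t / (t : ℂ)).im)

/-- The `d`-th moment of the `k`-th coordinate read off from a characteristic function:
`(-i)^d ∂^d φ / ∂ t_k^d` at `t = 0`. -/
def cfMoment {ι : Type*} [DecidableEq ι] (φ : (ι → ℝ) → ℂ) (d : ℕ) (k : ι) : ℂ :=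
  (-Complex.I) ^ d * iteratedDeriv d (fun s : ℝ => φ (Pi.single k s)) 0

/-- Characteristic function of the random vector `X`. -/
def trueCF {ι Ω : Type*} [Fintype ι] [MeasurableSpace Ω] (μ : Measure Ω)
    (X : Ω → ι → ℝ) (t : ι → ℝ) : ℂ :=
  charFun (μ.map (fun ω => WithLp.toLp 2 (X ω))) (WithLp.toLp 2 t)

/-- Smoothed empirical characteristic function of the first `Ns` samples, with weights `1 / Ns`. -/
def sampleCF {ι : Type*} [Fintype ι] (Ns : ℕ) (Sig : Matrix ι ι ℝ) (w : ℕ → ι → ℝ) :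
    (ι → ℝ) → ℂ :=
  ecf (fun _ : Fin Ns => 1 / (Ns : ℝ)) Sig (fun j : Fin Ns => w j)

/-- Approximate CDF of `v ⬝ᵥ w`, obtained by inverting the smoothed empirical characteristic
function of the first `Ns` samples, with weights `1 / Ns`. -/
def sampleCDF {ι : Type*} [Fintype ι] (Ns : ℕ) (Sig : Matrix ι ι ℝ) (w : ℕ → ι → ℝ)
    (v : ι → ℝ) : ℝ → ℝ :=
  gilPelaez (ecfScalar (fun _ : Fin Ns => 1 / (Ns : ℝ)) Sig (fun j : Fin Ns => w j) v)

/-! ### Piecewise affine under-approximation and the convex program -/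

/-- A minimum of finitely many (at least one) affine functions `a r * x + c r`, together with a
left end point `xlb` of its domain `[xlb, ∞)`. -/
structure PWA where
  z : ℕ
  z_pos : 0 < z
  a : Fin z → ℝ
  c : Fin z → ℝ
  xlb : ℝ

/-- The value `min_r (a r * x + c r)`. -/
def PWA.eval (L : PWA) (x : ℝ) : ℝ :=
  Finset.univ.inf' ⟨(⟨0, L.z_pos⟩ : Fin L.z), Finset.mem_univ _⟩ (fun r => L.a r * x + L.c r)

/-- `L` under-approximates `F` on `[xlb, ∞)` with error at most `ε`. -/
def PWA.UnderApprox (L : PWA) (F : ℝ → ℝ) (ε : ℝ) : Prop :=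
  ∀ x, L.xlb ≤ x → 0 ≤ F x - L.eval x ∧ F x - L.eval x ≤ ε

/-- Feasible pairs (input, risk allocation) of the convex program built from the piecewise affine
functions `L i`. -/
def ControlData.convexFeasible {n m p l N : ℕ} (D : ControlData n m p l N) (L : Fin l → PWA) :
    Set ((Fin N × Fin m → ℝ) × (Fin l → ℝ)) :=
  {s | (∀ i, ∀ r, 1 - s.2 i ≤ (L i).a r * D.margin i s.1 + (L i).c r) ∧
    (∀ i, (L i).xlb ≤ D.margin i s.1) ∧
    (∑ i, s.2 i ≤ D.Δ ∧ ∀ i, 0 ≤ s.2 i) ∧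
    s.1 ∈ D.inputSet}

end

/-! Inversion is linear, and the smoothed empirical characteristic function of `v ⬝ᵥ wbar` is an
average of characteristic functions of normal laws centred at the projected samples, with common
variance σ² = vᵀΣv. Hence the approximate CDF is an average of Gaussian CDFs
(`gilPelaez_ecfScalar`), atoms counting half when σ² = 0. By Chebyshev, its value at x lies between
the empirical CDFs at x - r and x + r, up to an error σ²/r².

Everything then rests on σ² → 0 in probability (`tendstoInMeasure_quadForm_zero`). By the law of
large numbers the unsmoothed empirical characteristic function has the same limit as the smoothed
one, so the damping factor must tend to 1 wherever that limit is nonzero, in particular near the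
origin. The CDFs now converge by the law of large numbers for half-space indicators. The moments are
sample moments, plus a diagonal entry of Σ for the second one.

Feasibility needs only the upper bound on the approximate CDFs. By right continuity it holds at
every point b, uniformly on a half line reaching slightly beyond b. If an admissible u is
infeasible, Boole's inequality leaves a gap ∑ (1 - Φᵢ) > Δ, whereas convex feasibility forces ∑ (1 -
Φ̂ᵢ) ≤ Δ. So convex feasibility near u has vanishing probability, and compactness of the input box
makes this uniform. -/

/-! ### The Dirichlet integral, with a rate -/

/-- The Laplace-type integral of the sine over a finite interval. -/
theorem integral_sin_mul_exp_neg (u T : ℝ) :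
    ∫ s in (0 : ℝ)..T, Real.sin s * Real.exp (-(s * u)) =
      (1 + u ^ 2)⁻¹ - Real.exp (-(T * u)) * (Real.cos T + u * Real.sin T) * (1 + u ^ 2)⁻¹ := by
  have hpos : (1 + u ^ 2) ≠ 0 := by positivity
  have hderiv : ∀ s ∈ Set.uIcc 0 T, HasDerivAt
      (fun s => -(Real.exp (-(s * u)) * (Real.cos s + u * Real.sin s) * (1 + u ^ 2)⁻¹))
      (Real.sin s * Real.exp (-(s * u))) s := by
    intro s _
    have h1 : HasDerivAt (fun s : ℝ => Real.exp (-(s * u))) (Real.exp (-(s * u)) * (-(1 * u))) s :=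
      (((hasDerivAt_id s).mul_const u).neg).exp
    have h2 : HasDerivAt (fun s : ℝ => Real.cos s + u * Real.sin s)
        (-Real.sin s + u * Real.cos s) s :=
      (Real.hasDerivAt_cos s).add ((Real.hasDerivAt_sin s).const_mul u)
    convert! ((h1.mul h2).mul_const (1 + u ^ 2)⁻¹).neg using 1
    field_simp
    ring
  rw [intervalIntegral.integral_eq_sub_of_hasDerivAt hderiv
    (by apply Continuous.intervalIntegrable; fun_prop)]
  simp
  ring

theorem integral_Ioi_exp_neg_mul {s : ℝ} (hs : 0 < s) :
    ∫ u in Set.Ioi (0 : ℝ), Real.exp (-(s * u)) = s⁻¹ := by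
  have := integral_exp_mul_Ioi (a := -s) (by linarith) 0
  simpa [neg_mul] using this

theorem integrableOn_exp_neg_mul {s : ℝ} (hs : 0 < s) :
    IntegrableOn (fun u : ℝ => Real.exp (-(s * u))) (Set.Ioi 0) := by
  simpa [neg_mul] using integrableOn_exp_mul_Ioi (a := -s) (by linarith) 0

/-- Distance of the sine integral to its limit. -/
theorem abs_integral_sinc_sub_le {T : ℝ} (hT : 0 < T) :
    |(∫ s in (0 : ℝ)..T, Real.sinc s) - Real.pi / 2| ≤ 2 / T := by
  have hmeas : AEStronglyMeasurable
      (Function.uncurry fun s u : ℝ => Real.sin s * Real.exp (-(s * u)))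
      ((volume.restrict (Set.uIoc 0 T)).prod (volume.restrict (Set.Ioi (0 : ℝ)))) := by
    apply Continuous.aestronglyMeasurable
    simp only [Function.uncurry_def]
    fun_prop
  have hint : Integrable (Function.uncurry fun s u : ℝ => Real.sin s * Real.exp (-(s * u)))
      ((volume.restrict (Set.uIoc 0 T)).prod (volume.restrict (Set.Ioi (0 : ℝ)))) := by
    -- The inner integral of the norm is |sin s| / s = |sinc s|, which is integrable up to 0.
    rw [integrable_prod_iff hmeas]
    rw [Set.uIoc_of_le hT.le]
    constructor
    · filter_upwards [ae_restrict_mem measurableSet_Ioc] with s hs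
      exact Integrable.const_mul (integrableOn_exp_neg_mul hs.1) (Real.sin s)
    · have hb : IntegrableOn (fun s => |Real.sinc s|) (Set.Ioc 0 T) :=
        (Real.continuous_sinc.abs.intervalIntegrable 0 T).1
      refine hb.congr ?_
      filter_upwards [ae_restrict_mem measurableSet_Ioc] with s hs
      simp only [Function.uncurry, norm_mul, Real.norm_eq_abs, Real.abs_exp]
      rw [integral_const_mul, integral_Ioi_exp_neg_mul hs.1, Real.sinc_of_ne_zero hs.1.ne',
        abs_div, abs_of_pos hs.1, div_eq_mul_inv]
  -- Since 1/s = ∫ exp(-su) du over u > 0, swapping turns the sine integral into ∫ du/(1 + u²) = π/2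
  -- minus a remainder of size 2/T.
  have hswap := intervalIntegral_integral_swap hint
  have hleft : ∫ s in (0 : ℝ)..T, ∫ u in Set.Ioi (0 : ℝ), Real.sin s * Real.exp (-(s * u)) =
      ∫ s in (0 : ℝ)..T, Real.sinc s := by
    rw [intervalIntegral.integral_of_le hT.le, intervalIntegral.integral_of_le hT.le]
    refine setIntegral_congr_fun measurableSet_Ioc fun s hs => ?_
    rw [integral_const_mul, integral_Ioi_exp_neg_mul hs.1, Real.sinc_of_ne_zero hs.1.ne',
      div_eq_mul_inv]
  have hbound : ∀ u ∈ Set.Ioi (0 : ℝ),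
      ‖Real.exp (-(T * u)) * (Real.cos T + u * Real.sin T) * (1 + u ^ 2)⁻¹‖ ≤
        2 * Real.exp (-(T * u)) := by
    intro u hu
    have hu : 0 < u := hu
    rw [norm_mul, norm_mul, Real.norm_eq_abs, Real.norm_eq_abs, Real.norm_eq_abs, Real.abs_exp,
      abs_of_pos (show 0 < (1 + u ^ 2)⁻¹ by positivity), mul_assoc, mul_comm]
    refine mul_le_mul_of_nonneg_right ?_ (Real.exp_pos _).le
    rw [← div_eq_mul_inv, div_le_iff₀ (by positivity)]
    calc |Real.cos T + u * Real.sin T| ≤ |Real.cos T| + |u * Real.sin T| := abs_add_le _ _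
      _ ≤ 1 + u * 1 := by
        rw [abs_mul, abs_of_pos hu]
        gcongr
        · exact Real.abs_cos_le_one T
        · exact Real.abs_sin_le_one T
      _ ≤ 2 * (1 + u ^ 2) := by nlinarith [sq_nonneg (u - 1)]
  have hdom : IntegrableOn (fun u : ℝ => 2 * Real.exp (-(T * u))) (Set.Ioi 0) :=
    (integrableOn_exp_neg_mul hT).const_mul 2
  have hrem : IntegrableOn (fun u : ℝ =>
      Real.exp (-(T * u)) * (Real.cos T + u * Real.sin T) * (1 + u ^ 2)⁻¹) (Set.Ioi 0) := by
    refine Integrable.mono' hdom ?_ ?_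
    · apply Measurable.aestronglyMeasurable; fun_prop
    · filter_upwards [ae_restrict_mem measurableSet_Ioi] with u hu using hbound u hu
  rw [← hleft, hswap]
  simp_rw [integral_sin_mul_exp_neg]
  rw [← Real.norm_eq_abs, integral_sub integrable_inv_one_add_sq.integrableOn hrem,
    integral_Ioi_inv_one_add_sq, Real.arctan_zero, sub_zero, sub_sub_cancel_left, norm_neg]
  calc _ ≤ ∫ u in Set.Ioi (0 : ℝ), 2 * Real.exp (-(T * u)) := by
        refine norm_integral_le_of_norm_le hdom ?_
        filter_upwards [ae_restrict_mem measurableSet_Ioi] with u hu using hbound u hu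
    _ = 2 / T := by rw [integral_const_mul, integral_Ioi_exp_neg_mul hT, div_eq_mul_inv]

/-- **Dirichlet integral**. -/
theorem tendsto_integral_sinc_atTop :
    Tendsto (fun T : ℝ => ∫ s in (0 : ℝ)..T, Real.sinc s) atTop (𝓝 (Real.pi / 2)) := by
  rw [tendsto_iff_norm_sub_tendsto_zero]
  refine squeeze_zero' (Eventually.of_forall fun _ => norm_nonneg _) ?_
    ((tendsto_const_nhds (x := (2 : ℝ))).div_atTop tendsto_id)
  filter_upwards [eventually_gt_atTop 0] with T hT using abs_integral_sinc_sub_le hT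

theorem integral_sinc_neg (T : ℝ) :
    ∫ s in (0 : ℝ)..(-T), Real.sinc s = -∫ s in (0 : ℝ)..T, Real.sinc s := by
  have h := intervalIntegral.integral_comp_neg (a := 0) (b := T) Real.sinc
  simp only [Real.sinc_neg, neg_zero] at h
  rw [h, intervalIntegral.integral_symm]

/-- Dominating constant for the limit in the inversion formula. Up to T = 1 the bound |sinc| ≤ 1
suffices; beyond it the integral is within 2 of π/2, and π ≤ 4. -/
theorem abs_integral_sinc_le (T : ℝ) : |∫ s in (0 : ℝ)..T, Real.sinc s| ≤ 4 := by
  have key : ∀ T : ℝ, 0 ≤ T → |∫ s in (0 : ℝ)..T, Real.sinc s| ≤ 4 := by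
    intro T hT
    rcases le_or_gt T 1 with h | h
    · have := intervalIntegral.norm_integral_le_of_norm_le_const (a := 0) (b := T)
        (f := Real.sinc) (C := 1) fun x _ => Real.abs_sinc_le_one x
      rw [Real.norm_eq_abs, sub_zero, abs_of_nonneg hT] at this
      linarith
    · have h1 := abs_integral_sinc_sub_le (zero_lt_one.trans h)
      have h2 : 2 / T ≤ 2 := by rw [div_le_iff₀ (by linarith)]; linarith
      have h3 := Real.pi_le_four
      have h4 := Real.pi_pos
      rw [abs_le] at h1 ⊢
      constructor <;> linarith [h1.1, h1.2]
  rcases le_total 0 T with h | h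
  · exact key T h
  · have := key (-T) (by linarith)
    rwa [integral_sinc_neg, abs_neg] at this

theorem tendsto_integral_sinc_mul_atTop (a : ℝ) :
    Tendsto (fun T : ℝ => ∫ s in (0 : ℝ)..(a * T), Real.sinc s) atTop
      (𝓝 (Real.pi / 2 * SignType.sign a)) := by
  rcases lt_trichotomy a 0 with h | h | h
  · have h1 : Tendsto (fun T : ℝ => -a * T) atTop atTop :=
      tendsto_id.const_mul_atTop (by linarith)
    have := (tendsto_integral_sinc_atTop.comp h1).neg
    simp only [Function.comp_def, neg_mul, integral_sinc_neg, neg_neg] at this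
    simpa [sign_neg h] using this
  · simp [h]
  · have h1 : Tendsto (fun T : ℝ => a * T) atTop atTop := tendsto_id.const_mul_atTop h
    simpa [sign_pos h, Function.comp_def] using tendsto_integral_sinc_atTop.comp h1

/-! ### Gil-Pelaez inversion -/

/-- The mass strictly to the left of `x`, plus half of the atom at `x`. -/
noncomputable def midCDF (ν : Measure ℝ) (x : ℝ) : ℝ := ν.real (Set.Iio x) + ν.real {x} / 2

theorem integral_mul_sinc_mul (a T : ℝ) :
    ∫ t in (0 : ℝ)..T, a * Real.sinc (a * t) = ∫ s in (0 : ℝ)..(a * T), Real.sinc s := by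
  simp [intervalIntegral.integral_const_mul]

/-- Writing the integrand with `sinc` removes the singularity at t = 0: it is bounded by |y - x| for
all t. -/
theorem im_exp_mul_charFun_div (ν : Measure ℝ) [IsFiniteMeasure ν] (x : ℝ) {t : ℝ} (ht : t ≠ 0) :
    (Complex.exp (-(Complex.I * (t : ℂ) * (x : ℂ))) * charFun ν t / (t : ℂ)).im =
      ∫ y, (y - x) * Real.sinc ((y - x) * t) ∂ν := by
  have hint : Integrable (fun y : ℝ => Complex.exp (-(Complex.I * (t : ℂ) * (x : ℂ))) *
      Complex.exp (t * y * Complex.I) / (t : ℂ)) ν := by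
    refine Integrable.div_const (Integrable.const_mul ?_ _) _
    refine Integrable.of_bound (C := 1) (by fun_prop) (Eventually.of_forall fun y => ?_)
    rw [← Complex.ofReal_mul, Complex.norm_exp_ofReal_mul_I]
  rw [charFun_apply_real, ← integral_const_mul, ← integral_div]
  refine ((integral_im hint).symm.trans ?_)
  refine integral_congr_ae (Eventually.of_forall fun y => ?_)
  have h1 : Complex.exp (-(Complex.I * (t : ℂ) * (x : ℂ))) * Complex.exp (t * y * Complex.I) =
      Complex.exp ((((y - x) * t : ℝ) : ℂ) * Complex.I) := by
    rw [← Complex.exp_add]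
    push_cast
    ring_nf
  simp only [h1, RCLike.im_to_complex, Complex.div_ofReal_im, Complex.exp_ofReal_mul_I_im]
  rcases eq_or_ne (y - x) 0 with h | h
  · simp [h]
  · rw [Real.sinc_of_ne_zero (mul_ne_zero h ht)]
    field_simp

/-- **Gil-Pelaez inversion** for a measure with finite first moment. -/
theorem tendsto_integral_im_exp_mul_charFun_div (ν : Measure ℝ) [IsProbabilityMeasure ν]
    (hν : Integrable id ν) (x : ℝ) :
    Tendsto (fun T : ℝ => ∫ t in (0 : ℝ)..T,
      (Complex.exp (-(Complex.I * (t : ℂ) * (x : ℂ))) * charFun ν t / (t : ℂ)).im) atTop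
      (𝓝 (Real.pi * (1 / 2 - midCDF ν x))) := by
  have hfub : ∀ T : ℝ, ∫ t in (0 : ℝ)..T,
      (Complex.exp (-(Complex.I * (t : ℂ) * (x : ℂ))) * charFun ν t / (t : ℂ)).im =
      ∫ y, (∫ s in (0 : ℝ)..((y - x) * T), Real.sinc s) ∂ν := by
    intro T
    have : IsFiniteMeasure (volume.restrict (Set.uIoc 0 T)) :=
      isFiniteMeasure_restrict.2 (by simp [Set.uIoc])
    have hint : Integrable (Function.uncurry fun t y : ℝ => (y - x) * Real.sinc ((y - x) * t))
        ((volume.restrict (Set.uIoc 0 T)).prod ν) := by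
      -- The finite first moment enters here: |sinc| ≤ 1 leaves |y - x| as dominating function.
      have hdom : Integrable (fun z : ℝ × ℝ => z.2 - x) ((volume.restrict (Set.uIoc 0 T)).prod ν) :=
        Integrable.comp_snd (hν.sub (integrable_const x)) _
      refine Integrable.mono hdom ?_ (Eventually.of_forall fun z => ?_)
      · apply Continuous.aestronglyMeasurable
        simp only [Function.uncurry_def]
        have := Real.continuous_sinc
        fun_prop
      · simp only [Function.uncurry, norm_mul]
        exact mul_le_of_le_one_right (norm_nonneg _) (Real.abs_sinc_le_one _)
    have hswap := intervalIntegral_integral_swap hint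
    simp_rw [integral_mul_sinc_mul] at hswap
    rw [← hswap]
    refine intervalIntegral.integral_congr_ae ?_
    filter_upwards [compl_mem_ae_iff.2 (measure_singleton (μ := volume) (0 : ℝ))] with t ht _
    exact im_exp_mul_charFun_div ν x ht
  simp_rw [hfub]
  have hlim : Tendsto (fun T : ℝ => ∫ y, (∫ s in (0 : ℝ)..((y - x) * T), Real.sinc s) ∂ν) atTop
      (𝓝 (∫ y, Real.pi / 2 * SignType.sign (y - x) ∂ν)) := by
    refine tendsto_integral_filter_of_dominated_convergence (fun _ => 4) ?_ ?_
      (integrable_const _) ?_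
    · refine Eventually.of_forall fun T => Continuous.aestronglyMeasurable ?_
      have : Continuous fun b : ℝ => ∫ s in (0 : ℝ)..b, Real.sinc s :=
        intervalIntegral.continuous_primitive
          (fun a b => Real.continuous_sinc.intervalIntegrable a b) 0
      fun_prop
    · exact Eventually.of_forall fun T => Eventually.of_forall fun y => abs_integral_sinc_le _
    · exact Eventually.of_forall fun y => tendsto_integral_sinc_mul_atTop (y - x)
  convert hlim using 2
  -- The sign is 1 - (2·1_{y<x} + 1_{y=x}), with integral 1 - 2 `midCDF ν x`; the half weight of the
  -- atom comes from sign 0 = 0.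
  have hsign : ∀ y : ℝ, Real.pi / 2 * (SignType.sign (y - x) : ℝ) = Real.pi / 2 *
      (1 - (2 * (Set.Iio x).indicator (fun _ => (1 : ℝ)) y +
        ({x} : Set ℝ).indicator (fun _ => (1 : ℝ)) y)) := by
    intro y
    rcases lt_trichotomy y x with h | h | h
    · rw [sign_neg (sub_neg.2 h)]
      simp [h, h.ne]
      norm_num
    · simp [h]
    · rw [sign_pos (sub_pos.2 h)]
      simp [h.le, h.ne']
  have i1 : Integrable ((Set.Iio x).indicator fun _ : ℝ => (1 : ℝ)) ν :=
    (integrable_const 1).indicator measurableSet_Iio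
  have i2 : Integrable (({x} : Set ℝ).indicator fun _ : ℝ => (1 : ℝ)) ν :=
    (integrable_const 1).indicator (measurableSet_singleton x)
  have i3 : Integrable (fun y : ℝ => 2 * (Set.Iio x).indicator (fun _ => (1 : ℝ)) y +
      ({x} : Set ℝ).indicator (fun _ => (1 : ℝ)) y) ν := (i1.const_mul 2).add i2
  simp_rw [hsign]
  rw [integral_const_mul, integral_sub (integrable_const _) i3,
    integral_add (i1.const_mul 2) i2, integral_const_mul, integral_indicator measurableSet_Iio,
    integral_indicator (measurableSet_singleton x)]
  simp [midCDF, measureReal_def]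
  ring

/-! ### The approximate CDF as a Gaussian mixture -/

theorem ecfScalar_eq_sum_charFun {κ ι : Type*} [Fintype κ] [Fintype ι] (α : κ → ℝ)
    {Sig : Matrix ι ι ℝ} (w : κ → ι → ℝ) {v : ι → ℝ} (h : 0 ≤ v ⬝ᵥ (Sig *ᵥ v)) (t : ℝ) :
    ecfScalar α Sig w v t =
      ∑ j, (α j : ℂ) * charFun (gaussianReal (v ⬝ᵥ w j) (v ⬝ᵥ (Sig *ᵥ v)).toNNReal) t := by
  refine Finset.sum_congr rfl fun j _ => ?_
  rw [charFun_gaussianReal, ← Complex.exp_add]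
  congr 2
  have : (((v ⬝ᵥ (Sig *ᵥ v)).toNNReal : ℝ) : ℂ) = ((v ⬝ᵥ (Sig *ᵥ v) : ℝ) : ℂ) := by
    rw [Real.coe_toNNReal _ h]
  rw [this]
  push_cast
  ring

/-- The inverted smoothed empirical characteristic function is a Gaussian mixture. -/
theorem gilPelaez_ecfScalar {κ ι : Type*} [Fintype κ] [Fintype ι] (α : κ → ℝ) (hα : ∑ j, α j = 1)
    {Sig : Matrix ι ι ℝ} (w : κ → ι → ℝ) {v : ι → ℝ} (h : 0 ≤ v ⬝ᵥ (Sig *ᵥ v)) (x : ℝ) :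
    gilPelaez (ecfScalar α Sig w v) x =
      ∑ j, α j * midCDF (gaussianReal (v ⬝ᵥ w j) (v ⬝ᵥ (Sig *ᵥ v)).toNNReal) x := by
  set ν : κ → Measure ℝ := fun j => gaussianReal (v ⬝ᵥ w j) (v ⬝ᵥ (Sig *ᵥ v)).toNNReal with hνdef
  have hνint : ∀ j, Integrable id (ν j) := fun j =>
    memLp_one_iff_integrable.1 (by simpa using memLp_id_gaussianReal 1)
  have hii : ∀ j (T : ℝ), IntervalIntegrable (fun t : ℝ =>
      (Complex.exp (-(Complex.I * (t : ℂ) * (x : ℂ))) * charFun (ν j) t / (t : ℂ)).im)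
      volume 0 T := by
    intro j T
    have hm : Measurable fun t : ℝ =>
        (Complex.exp (-(Complex.I * (t : ℂ) * (x : ℂ))) * charFun (ν j) t / (t : ℂ)).im := by
      have := measurable_charFun (μ := ν j)
      fun_prop
    refine (intervalIntegrable_const (c := ∫ y, |y - x| ∂(ν j))).mono_fun
      hm.aestronglyMeasurable ?_
    filter_upwards [ae_restrict_of_ae
      (compl_mem_ae_iff.2 (measure_singleton (μ := volume) (0 : ℝ)))] with t ht
    rw [im_exp_mul_charFun_div (ν j) x ht]
    refine (norm_integral_le_of_norm_le ((hνint j).sub (integrable_const x)).abs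
      (Eventually.of_forall fun y => ?_)).trans (le_abs_self _)
    rw [norm_mul]
    exact mul_le_of_le_one_right (norm_nonneg _) (Real.abs_sinc_le_one _)
  have hlim : Tendsto (fun T : ℝ => ∫ t in (0 : ℝ)..T,
      (Complex.exp (-(Complex.I * (t : ℂ) * (x : ℂ))) * ecfScalar α Sig w v t / (t : ℂ)).im) atTop
      (𝓝 (∑ j, α j * (Real.pi * (1 / 2 - midCDF (ν j) x)))) := by
    have := tendsto_finsetSum Finset.univ fun j _ =>
      (tendsto_integral_im_exp_mul_charFun_div (ν j) (hνint j) x).const_mul (α j)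
    refine this.congr fun T => ?_
    simp_rw [← intervalIntegral.integral_const_mul]
    rw [← intervalIntegral.integral_finsetSum fun j _ => (hii j T).const_mul (α j)]
    congr 1 with t
    rw [ecfScalar_eq_sum_charFun α w h, Finset.mul_sum, Finset.sum_div, Complex.im_sum]
    refine Finset.sum_congr rfl fun j _ => ?_
    rw [← Complex.im_ofReal_mul]
    congr 1
    ring
  -- `limUnder` has the intended value because `hlim` proves that the improper integral converges.
  rw [gilPelaez, hlim.limUnder_eq]
  have : ∑ j, α j * (Real.pi * (1 / 2 - midCDF (ν j) x)) =
      Real.pi * (1 / 2 * ∑ j, α j - ∑ j, α j * midCDF (ν j) x) := by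
    rw [mul_sub, Finset.mul_sum, Finset.mul_sum, Finset.mul_sum, ← Finset.sum_sub_distrib]
    exact Finset.sum_congr rfl fun j _ => by ring
  rw [this, hα]
  field_simp
  ring

/-! ### Chebyshev bounds for the mixture components -/

theorem midCDF_nonneg (ν : Measure ℝ) (x : ℝ) : 0 ≤ midCDF ν x := by
  unfold midCDF; positivity

theorem midCDF_le_measureReal_Iic (ν : Measure ℝ) [IsFiniteMeasure ν] (x : ℝ) :
    midCDF ν x ≤ ν.real (Set.Iic x) := by
  have h : ν.real (Set.Iic x) = ν.real (Set.Iio x) + ν.real {x} := by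
    rw [← measureReal_union (by simp) (measurableSet_singleton x), Set.Iio_union_right]
  have := measureReal_nonneg (μ := ν) (s := {x})
  unfold midCDF
  linarith

theorem midCDF_le_one (ν : Measure ℝ) [IsProbabilityMeasure ν] (x : ℝ) : midCDF ν x ≤ 1 :=
  (midCDF_le_measureReal_Iic ν x).trans measureReal_le_one

theorem gaussianReal_real_abs_sub_le (m : ℝ) (s : NNReal) {r : ℝ} (hr : 0 < r) :
    (gaussianReal m s).real {y | r ≤ |y - m|} ≤ s / r ^ 2 := by
  have := meas_ge_le_variance_div_sq (μ := gaussianReal m s) (X := id)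
    (by simpa using memLp_id_gaussianReal 2) hr
  simp only [id_eq, integral_id_gaussianReal, variance_id_gaussianReal] at this
  exact ENNReal.toReal_le_of_le_ofReal (by positivity) this

theorem midCDF_gaussianReal_le {m x r : ℝ} (s : NNReal) (hr : 0 < r) (h : x + r ≤ m) :
    midCDF (gaussianReal m s) x ≤ s / r ^ 2 := by
  refine (midCDF_le_measureReal_Iic _ x).trans
    ((measureReal_mono fun y hy => ?_).trans (gaussianReal_real_abs_sub_le m s hr))
  have hy : y ≤ x := hy
  have : m - y ≤ |y - m| := by rw [abs_sub_comm]; exact le_abs_self _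
  exact le_trans (by linarith) this

theorem le_midCDF_gaussianReal {m x r : ℝ} (s : NNReal) (hr : 0 < r) (h : m + r ≤ x) :
    1 - s / r ^ 2 ≤ midCDF (gaussianReal m s) x := by
  have h1 : (gaussianReal m s).real (Set.Ici x) ≤ s / r ^ 2 := by
    refine (measureReal_mono fun y hy => ?_).trans (gaussianReal_real_abs_sub_le m s hr)
    have hy : x ≤ y := hy
    exact le_trans (by linarith) (le_abs_self (y - m))
  have h2 := probReal_compl_eq_one_sub (μ := gaussianReal m s) (measurableSet_Ici (a := x))
  rw [Set.compl_Ici] at h2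
  have := measureReal_nonneg (μ := gaussianReal m s) (s := {x})
  unfold midCDF
  linarith

/-! ### Null limits of outer probabilities -/

section OuterMeasure

variable {Ω : Type*} [MeasurableSpace Ω] {μ : Measure Ω} {A B : ℕ → Set Ω}

theorem tendsto_measure_zero_mono (hB : Tendsto (fun n => μ (B n)) atTop (𝓝 0))
    (h : ∀ᶠ n in atTop, A n ⊆ B n) : Tendsto (fun n => μ (A n)) atTop (𝓝 0) :=
  tendsto_of_tendsto_of_tendsto_of_le_of_le' tendsto_const_nhds hB
    (Eventually.of_forall fun _ => zero_le) (h.mono fun _ hn => measure_mono hn)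

theorem tendsto_measure_zero_union (hA : Tendsto (fun n => μ (A n)) atTop (𝓝 0))
    (hB : Tendsto (fun n => μ (B n)) atTop (𝓝 0)) :
    Tendsto (fun n => μ (A n ∪ B n)) atTop (𝓝 0) :=
  tendsto_of_tendsto_of_tendsto_of_le_of_le tendsto_const_nhds (by simpa using hA.add hB)
    (fun _ => zero_le) fun n => measure_union_le (A n) (B n)

theorem tendsto_measure_zero_iUnion {κ : Type*} [Fintype κ] {A : κ → ℕ → Set Ω}
    (hA : ∀ i, Tendsto (fun n => μ (A i n)) atTop (𝓝 0)) :
    Tendsto (fun n => μ (⋃ i, A i n)) atTop (𝓝 0) :=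
  tendsto_of_tendsto_of_tendsto_of_le_of_le tendsto_const_nhds
    (by simpa using tendsto_finsetSum Finset.univ fun i _ => hA i)
    (fun _ => zero_le) fun n => measure_iUnion_fintype_le μ fun i => A i n

/-- A deviation of ε forces one of ε/2 in a summand. No measurability is assumed, as the smoothing
matrices are arbitrary functions of the outcome. -/
theorem tendstoInMeasure_add {E : Type*} [SeminormedAddCommGroup E]
    {f g : ℕ → Ω → E} {F G : Ω → E}
    (hf : TendstoInMeasure μ f atTop F) (hg : TendstoInMeasure μ g atTop G) :
    TendstoInMeasure μ (fun n ω => f n ω + g n ω) atTop (fun ω => F ω + G ω) := by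
  rw [tendstoInMeasure_iff_norm] at hf hg ⊢
  intro ε hε
  refine tendsto_measure_zero_mono (tendsto_measure_zero_union (hf (ε / 2) (by positivity))
    (hg (ε / 2) (by positivity))) (Eventually.of_forall fun n ω hω => ?_)
  by_contra hcon
  simp only [Set.mem_union, Set.mem_ofPred_eq, not_or, not_le] at hcon hω
  have h1 : ‖f n ω + g n ω - (F ω + G ω)‖ ≤ ‖f n ω - F ω‖ + ‖g n ω - G ω‖ := by
    rw [add_sub_add_comm]
    exact norm_add_le _ _
  linarith [hcon.1, hcon.2]

end OuterMeasure

/-! ### Law of large numbers -/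

section LawOfLargeNumbers

variable {ι Ω : Type*} [MeasurableSpace Ω] {μ : Measure Ω} [IsProbabilityMeasure μ]
  {wbar : Ω → ι → ℝ} {w : ℕ → Ω → ι → ℝ}

/-- Weak law of large numbers for a function of i.i.d. samples. -/
theorem tendstoInMeasure_average {E : Type*} [NormedAddCommGroup E] [NormedSpace ℝ E]
    [CompleteSpace E] [MeasurableSpace E] [BorelSpace E]
    (hindep : iIndepFun w μ) (hident : ∀ j, IdentDistrib (w j) wbar μ μ)
    {g : (ι → ℝ) → E} (hg : Measurable g) (hgi : Integrable (fun ω => g (wbar ω)) μ) :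
    TendstoInMeasure μ (fun (n : ℕ) ω => (n : ℝ)⁻¹ • ∑ j ∈ Finset.range n, g (w j ω)) atTop
      (fun _ => ∫ ω, g (wbar ω) ∂μ) := by
  have hid : ∀ j, IdentDistrib (fun ω => g (w j ω)) (fun ω => g (wbar ω)) μ μ :=
    fun j => (hident j).comp hg
  have hi : ∀ j, Integrable (fun ω => g (w j ω)) μ := fun j => (hid j).integrable_iff.2 hgi
  refine tendstoInMeasure_of_tendsto_ae (fun n => ?_) ?_
  · exact (Finset.aestronglyMeasurable_fun_sum _ fun j _ => (hi j).1).const_smul _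
  · have := strong_law_ae (fun j ω => g (w j ω)) (hi 0)
      (fun i j hij => (hindep.indepFun hij).comp hg hg)
      (fun j => (hid j).trans (hid 0).symm)
    rwa [(hid 0).integral_eq] at this

end LawOfLargeNumbers

/-! ### Vanishing smoothing and convergence of the approximate CDFs -/

section Samples

variable {ι : Type*} [Fintype ι]

/-- The damping factor is common to all samples, so it splits off from the plain empirical
characteristic function. -/
theorem sampleCF_eq (Ns : ℕ) (Sig : Matrix ι ι ℝ) (w : ℕ → ι → ℝ) (t : ι → ℝ) :
    sampleCF Ns Sig w t =
      ((Ns : ℝ)⁻¹ • ∑ j ∈ Finset.range Ns, Complex.exp (Complex.I * ((t ⬝ᵥ w j : ℝ) : ℂ))) *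
        (Real.exp (-(1 / 2) * (t ⬝ᵥ (Sig *ᵥ t))) : ℝ) := by
  rw [sampleCF, ecf, Finset.sum_range, Complex.real_smul, Finset.mul_sum, Finset.sum_mul]
  refine Finset.sum_congr rfl fun j _ => ?_
  push_cast
  ring

theorem sampleCDF_eq {Ns : ℕ} (hNs : 1 ≤ Ns) {Sig : Matrix ι ι ℝ} (w : ℕ → ι → ℝ) {v : ι → ℝ}
    (h : 0 ≤ v ⬝ᵥ (Sig *ᵥ v)) (x : ℝ) :
    sampleCDF Ns Sig w v x = (Ns : ℝ)⁻¹ • ∑ j ∈ Finset.range Ns,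
      midCDF (gaussianReal (v ⬝ᵥ w j) (v ⬝ᵥ (Sig *ᵥ v)).toNNReal) x := by
  have hN : (Ns : ℝ) ≠ 0 := by positivity
  rw [sampleCDF, gilPelaez_ecfScalar _ (by simp [hN]) _ h, Finset.sum_range, smul_eq_mul,
    Finset.mul_sum]
  simp

theorem average_add_const {Ns : ℕ} (hNs : 1 ≤ Ns) (f : ℕ → ℝ) (c : ℝ) :
    (Ns : ℝ)⁻¹ • ∑ j ∈ Finset.range Ns, (f j + c) =
      (Ns : ℝ)⁻¹ • ∑ j ∈ Finset.range Ns, f j + c := by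
  have hN : (Ns : ℝ) ≠ 0 := by positivity
  rw [Finset.sum_add_distrib, smul_add]
  simp [hN]

/-- Indicator of the half space of vectors whose product with `v` is at most `b`. -/
noncomputable def halfSpaceIndicator (v : ι → ℝ) (b : ℝ) : (ι → ℝ) → ℝ :=
  {y | v ⬝ᵥ y ≤ b}.indicator fun _ => 1

/-- Samples projecting to at most b contribute at most 1 each; the others are centred at least r to
the right of x, where Chebyshev applies. -/
theorem sampleCDF_le {Ns : ℕ} (hNs : 1 ≤ Ns) {Sig : Matrix ι ι ℝ} (w : ℕ → ι → ℝ) {v : ι → ℝ}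
    (h : 0 ≤ v ⬝ᵥ (Sig *ᵥ v)) {x b r : ℝ} (hr : 0 < r) (hx : x + r ≤ b) :
    sampleCDF Ns Sig w v x ≤
      (Ns : ℝ)⁻¹ • ∑ j ∈ Finset.range Ns, halfSpaceIndicator v b (w j) +
        v ⬝ᵥ (Sig *ᵥ v) / r ^ 2 := by
  rw [sampleCDF_eq hNs w h, ← average_add_const hNs]
  refine smul_le_smul_of_nonneg_left (Finset.sum_le_sum fun j _ => ?_) (by positivity)
  have hpos : 0 ≤ v ⬝ᵥ (Sig *ᵥ v) / r ^ 2 := by positivity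
  by_cases hj : v ⬝ᵥ w j ≤ b
  · have := midCDF_le_one (gaussianReal (v ⬝ᵥ w j) (v ⬝ᵥ (Sig *ᵥ v)).toNNReal) x
    simp only [halfSpaceIndicator, Set.indicator, Set.mem_ofPred_eq, hj, if_true]
    linarith
  · have := midCDF_gaussianReal_le (m := v ⬝ᵥ w j) (x := x) (v ⬝ᵥ (Sig *ᵥ v)).toNNReal hr
      (by linarith)
    rw [Real.coe_toNNReal _ h] at this
    simp only [halfSpaceIndicator, Set.indicator, Set.mem_ofPred_eq, hj, if_false]
    linarith

theorem le_sampleCDF {Ns : ℕ} (hNs : 1 ≤ Ns) {Sig : Matrix ι ι ℝ} (w : ℕ → ι → ℝ) {v : ι → ℝ}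
    (h : 0 ≤ v ⬝ᵥ (Sig *ᵥ v)) {x b r : ℝ} (hr : 0 < r) (hx : b + r ≤ x) :
    (Ns : ℝ)⁻¹ • ∑ j ∈ Finset.range Ns, halfSpaceIndicator v b (w j) -
      v ⬝ᵥ (Sig *ᵥ v) / r ^ 2 ≤ sampleCDF Ns Sig w v x := by
  rw [sampleCDF_eq hNs w h, sub_eq_add_neg, ← average_add_const hNs]
  refine smul_le_smul_of_nonneg_left (Finset.sum_le_sum fun j _ => ?_) (by positivity)
  have hpos : 0 ≤ v ⬝ᵥ (Sig *ᵥ v) / r ^ 2 := by positivity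
  by_cases hj : v ⬝ᵥ w j ≤ b
  · have := le_midCDF_gaussianReal (m := v ⬝ᵥ w j) (x := x) (v ⬝ᵥ (Sig *ᵥ v)).toNNReal hr
      (by linarith)
    rw [Real.coe_toNNReal _ h] at this
    simp only [halfSpaceIndicator, Set.indicator, Set.mem_ofPred_eq, hj, if_true]
    linarith
  · have := midCDF_nonneg (gaussianReal (v ⬝ᵥ w j) (v ⬝ᵥ (Sig *ᵥ v)).toNNReal) x
    simp only [halfSpaceIndicator, Set.indicator, Set.mem_ofPred_eq, hj, if_false]
    linarith

theorem measurable_dotProduct_left (v : ι → ℝ) : Measurable fun y : ι → ℝ => v ⬝ᵥ y := by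
  unfold dotProduct
  fun_prop

variable {Ω : Type*} [MeasurableSpace Ω] {μ : Measure Ω} {wbar : Ω → ι → ℝ} {w : ℕ → Ω → ι → ℝ}

theorem trueCF_eq_integral (hw : AEMeasurable wbar μ) (t : ι → ℝ) :
    trueCF μ wbar t = ∫ ω, Complex.exp (Complex.I * ((t ⬝ᵥ wbar ω : ℝ) : ℂ)) ∂μ := by
  rw [trueCF, charFun_apply, integral_map]
  · refine integral_congr_ae (Eventually.of_forall fun ω => ?_)
    simp only [PiLp.inner_apply, dotProduct, mul_comm Complex.I]
    simp
  · exact (WithLp.measurable_toLp 2 (ι → ℝ)).comp_aemeasurable hw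
  · apply Continuous.aestronglyMeasurable
    fun_prop

variable [IsProbabilityMeasure μ]

theorem norm_exp_I_mul_ofReal (x : ℝ) : ‖Complex.exp (Complex.I * (x : ℂ))‖ = 1 := by
  rw [mul_comm, Complex.norm_exp_ofReal_mul_I]

theorem integrable_exp_I_mul_dotProduct (hw : AEMeasurable wbar μ) (t : ι → ℝ) :
    Integrable (fun ω => Complex.exp (Complex.I * ((t ⬝ᵥ wbar ω : ℝ) : ℂ))) μ := by
  have h := (measurable_dotProduct_left t).comp_aemeasurable hw
  refine Integrable.of_bound (C := 1) ?_
    (Eventually.of_forall fun ω => (norm_exp_I_mul_ofReal _).le)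
  have : AEMeasurable (fun ω => t ⬝ᵥ wbar ω) μ := h
  exact AEMeasurable.aestronglyMeasurable (by fun_prop)

/-- The characteristic function does not vanish at small multiples of a vector. -/
theorem exists_trueCF_smul_ne_zero (hw : AEMeasurable wbar μ) (v : ι → ℝ) :
    ∃ s : ℝ, s ≠ 0 ∧ trueCF μ wbar (s • v) ≠ 0 := by
  have hcont : Continuous fun s : ℝ => trueCF μ wbar (s • v) := by
    simp_rw [trueCF_eq_integral hw]
    refine continuous_of_dominated (bound := fun _ => 1)
      (fun s => (integrable_exp_I_mul_dotProduct hw (s • v)).1)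
      (fun s => Eventually.of_forall fun ω => (norm_exp_I_mul_ofReal _).le)
      (integrable_const _) (Eventually.of_forall fun ω => ?_)
    simp_rw [smul_dotProduct]
    fun_prop
  have h0 : trueCF μ wbar ((0 : ℝ) • v) ≠ 0 := by
    rw [trueCF_eq_integral hw]
    simp
  have := (hcont.continuousAt (x := 0)).eventually_ne h0
  obtain ⟨s, hs, hs0⟩ := ((this.filter_mono nhdsWithin_le_nhds).and
    (self_mem_nhdsWithin (a := (0 : ℝ)) (s := {0}ᶜ))).exists
  exact ⟨s, hs0, hs⟩

variable {Sig : ℕ → Ω → Matrix ι ι ℝ}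

/-- Convergence of the smoothed empirical characteristic function forces the smoothing matrices
to vanish asymptotically. -/
theorem tendstoInMeasure_quadForm_zero
    (hindep : iIndepFun w μ) (hident : ∀ j, IdentDistrib (w j) wbar μ μ)
    (hSig : ∀ Ns ω, (Sig Ns ω).PosSemidef)
    (hconv : ∀ t, TendstoInMeasure μ
      (fun Ns ω => sampleCF Ns (Sig Ns ω) (fun j => w j ω) t) atTop (fun _ => trueCF μ wbar t))
    (v : ι → ℝ) :
    TendstoInMeasure μ (fun Ns ω => v ⬝ᵥ (Sig Ns ω *ᵥ v)) atTop (fun _ => 0) := by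
  have hw : AEMeasurable wbar μ := (hident 0).aemeasurable_snd
  obtain ⟨s, hs0, hs⟩ := exists_trueCF_smul_ne_zero hw v
  have hsmooth := hconv (s • v)
  have hemp := tendstoInMeasure_average hindep hident
    (g := fun y => Complex.exp (Complex.I * (((s • v) ⬝ᵥ y : ℝ) : ℂ)))
    (by have := measurable_dotProduct_left (s • v); fun_prop)
    (integrable_exp_I_mul_dotProduct hw (s • v))
  rw [← trueCF_eq_integral hw] at hemp
  rw [tendstoInMeasure_iff_norm] at hsmooth hemp ⊢
  intro ζ hζ
  set c := ‖trueCF μ wbar (s • v)‖ with hc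
  have hcpos : 0 < c := norm_pos_iff.2 hs
  set ρ := Real.exp (-(1 / 2) * (s ^ 2 * ζ)) with hρ
  have hρ1 : ρ < 1 := by
    have : 0 < s ^ 2 * ζ := by positivity
    rw [hρ, Real.exp_lt_one_iff]
    linarith
  have hρ0 : 0 < ρ := Real.exp_pos _
  -- With g = (1 - ρ)c/2, if both empirical functions are within g of the limit and the damping is
  -- at most ρ, then c < ρ(c + g) + g < ρc + 2g = c, which is absurd.
  have hgap : 0 < (1 - ρ) * c / 2 := by
    have : 0 < 1 - ρ := by linarith
    positivity
  refine tendsto_measure_zero_mono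
    (tendsto_measure_zero_union (hsmooth _ hgap) (hemp _ hgap))
    (Eventually.of_forall fun n ω hω => ?_)
  by_contra hcon
  simp only [Set.mem_union, Set.mem_ofPred_eq, not_or, not_le] at hcon
  have hq : 0 ≤ v ⬝ᵥ (Sig n ω *ᵥ v) := by
    simpa using (hSig n ω).dotProduct_mulVec_nonneg v
  have hω : ζ ≤ v ⬝ᵥ (Sig n ω *ᵥ v) := by
    simpa [abs_of_nonneg hq] using hω
  rw [sampleCF_eq] at hcon
  set e := (n : ℝ)⁻¹ • ∑ j ∈ Finset.range n, Complex.exp (Complex.I * (((s • v) ⬝ᵥ w j ω : ℝ) : ℂ))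
    with he
  have hexp : Real.exp (-(1 / 2) * ((s • v) ⬝ᵥ (Sig n ω *ᵥ (s • v)))) ≤ ρ := by
    rw [hρ, Real.exp_le_exp, Matrix.mulVec_smul, dotProduct_smul, smul_dotProduct, smul_eq_mul,
      smul_eq_mul]
    have : s ^ 2 * ζ ≤ s ^ 2 * (v ⬝ᵥ (Sig n ω *ᵥ v)) := by gcongr
    nlinarith
  set κ := Real.exp (-(1 / 2) * ((s • v) ⬝ᵥ (Sig n ω *ᵥ (s • v)))) with hκ
  have hκ0 : 0 < κ := Real.exp_pos _
  have h1 : c ≤ ‖e * (κ : ℂ)‖ + ‖e * (κ : ℂ) - trueCF μ wbar (s • v)‖ := by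
    exact norm_le_norm_add_norm_sub _ _
  have h2 : ‖e‖ ≤ c + ‖e - trueCF μ wbar (s • v)‖ := norm_le_norm_add_norm_sub' _ _
  have h3 : ‖e * (κ : ℂ)‖ ≤ ρ * ‖e‖ := by
    rw [norm_mul, Complex.norm_real, Real.norm_of_nonneg hκ0.le, mul_comm]
    gcongr
  nlinarith [hcon.1, hcon.2, norm_nonneg (e - trueCF μ wbar (s • v))]

theorem integral_halfSpaceIndicator (hw : AEMeasurable wbar μ) (v : ι → ℝ) (b : ℝ) :
    ∫ ω, halfSpaceIndicator v b (wbar ω) ∂μ = cdf (μ.map fun ω => v ⬝ᵥ wbar ω) b := by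
  have hv : AEMeasurable (fun ω => v ⬝ᵥ wbar ω) μ :=
    (measurable_dotProduct_left v).comp_aemeasurable hw
  have := Measure.isProbabilityMeasure_map hv
  rw [cdf_eq_real, ← integral_indicator_one measurableSet_Iic, integral_map hv
    (by exact (measurable_const.indicator measurableSet_Iic).aestronglyMeasurable)]
  rfl

theorem measurable_halfSpaceIndicator (v : ι → ℝ) (b : ℝ) :
    Measurable (halfSpaceIndicator v b) :=
  measurable_const.indicator (measurable_dotProduct_left v measurableSet_Iic)

theorem tendstoInMeasure_average_halfSpaceIndicator
    (hindep : iIndepFun w μ) (hident : ∀ j, IdentDistrib (w j) wbar μ μ) (v : ι → ℝ) (b : ℝ) :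
    TendstoInMeasure μ
      (fun (n : ℕ) ω => (n : ℝ)⁻¹ • ∑ j ∈ Finset.range n, halfSpaceIndicator v b (w j ω)) atTop
      (fun _ => cdf (μ.map fun ω => v ⬝ᵥ wbar ω) b) := by
  have hw : AEMeasurable wbar μ := (hident 0).aemeasurable_snd
  have hm := measurable_halfSpaceIndicator v b
  rw [← integral_halfSpaceIndicator hw]
  refine tendstoInMeasure_average hindep hident hm ?_
  refine Integrable.of_bound (C := 1) (hm.comp_aemeasurable hw).aestronglyMeasurable
    (Eventually.of_forall fun ω => ?_)
  unfold halfSpaceIndicator Set.indicator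
  split_ifs <;> simp

/-- Asymptotic upper bound for the approximate CDF, uniform on a left half line. -/
theorem exists_tendsto_measure_cdf_add_le_sampleCDF
    (hindep : iIndepFun w μ) (hident : ∀ j, IdentDistrib (w j) wbar μ μ)
    (hSig : ∀ Ns ω, (Sig Ns ω).PosSemidef) {v : ι → ℝ}
    (hquad : TendstoInMeasure μ (fun Ns ω => v ⬝ᵥ (Sig Ns ω *ᵥ v)) atTop (fun _ => 0))
    (b : ℝ) {η : ℝ} (hη : 0 < η) :
    ∃ r, 0 < r ∧ Tendsto (fun Ns => μ {ω | ∃ x ≤ b + r,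
      cdf (μ.map fun ω => v ⬝ᵥ wbar ω) b + η ≤
        sampleCDF Ns (Sig Ns ω) (fun j => w j ω) v x}) atTop (𝓝 0) := by
  set F := cdf (μ.map fun ω => v ⬝ᵥ wbar ω) with hF
  -- One r covers the range x ≤ b + r, the other is the Chebyshev margin. The three thirds of η pay
  -- for the growth of F, the empirical error and the smoothing error.
  obtain ⟨r, hr, hFr⟩ : ∃ r, 0 < r ∧ F (b + r + r) < F b + η / 3 := by
    have h1 := (F.right_continuous b).tendsto.eventually_lt_const
      (show F b < F b + η / 3 by linarith)
    obtain ⟨δ, hδ, hδ'⟩ := Metric.mem_nhdsWithin_iff.1 h1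
    refine ⟨δ / 4, by positivity, hδ' ⟨?_, ?_⟩⟩
    · rw [Metric.mem_ball, Real.dist_eq, abs_of_nonneg (by linarith)]; linarith
    · simp only [Set.mem_Ici]; linarith
  refine ⟨r, hr, ?_⟩
  have hemp := tendstoInMeasure_average_halfSpaceIndicator hindep hident v (b + r + r)
  rw [tendstoInMeasure_iff_norm] at hemp hquad
  refine tendsto_measure_zero_mono (tendsto_measure_zero_union
    (hemp (η / 3) (by positivity)) (hquad (η / 3 * r ^ 2) (by positivity))) ?_
  filter_upwards [eventually_ge_atTop 1] with n hn ω hω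
  obtain ⟨x, hx, hle⟩ := hω
  by_contra hcon
  simp only [Set.mem_union, Set.mem_ofPred_eq, not_or, not_le, sub_zero, Real.norm_eq_abs] at hcon
  have hq : 0 ≤ v ⬝ᵥ (Sig n ω *ᵥ v) := by
    simpa using (hSig n ω).dotProduct_mulVec_nonneg v
  have h1 := sampleCDF_le hn (fun j => w j ω) hq hr (show x + r ≤ b + r + r by linarith)
  have h2 : v ⬝ᵥ (Sig n ω *ᵥ v) / r ^ 2 < η / 3 := by
    rw [div_lt_iff₀ (by positivity)]
    exact (le_abs_self _).trans_lt hcon.2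
  have h3 := (abs_lt.1 hcon.1).2
  linarith

/-- The lower bound compares with F at b - r and so needs left continuity: an atom at b may be
counted only in part. -/
theorem tendsto_measure_sampleCDF_le_cdf_sub
    (hindep : iIndepFun w μ) (hident : ∀ j, IdentDistrib (w j) wbar μ μ)
    (hSig : ∀ Ns ω, (Sig Ns ω).PosSemidef) {v : ι → ℝ}
    (hquad : TendstoInMeasure μ (fun Ns ω => v ⬝ᵥ (Sig Ns ω *ᵥ v)) atTop (fun _ => 0))
    {b : ℝ} (hb : ContinuousAt (cdf (μ.map fun ω => v ⬝ᵥ wbar ω)) b) {η : ℝ} (hη : 0 < η) :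
    Tendsto (fun Ns => μ {ω | sampleCDF Ns (Sig Ns ω) (fun j => w j ω) v b ≤
      cdf (μ.map fun ω => v ⬝ᵥ wbar ω) b - η}) atTop (𝓝 0) := by
  set F := cdf (μ.map fun ω => v ⬝ᵥ wbar ω) with hF
  obtain ⟨r, hr, hFr⟩ : ∃ r, 0 < r ∧ F b - η / 3 < F (b - r) := by
    have h1 := hb.tendsto.eventually_const_lt (show F b - η / 3 < F b by linarith)
    obtain ⟨δ, hδ, hδ'⟩ := Metric.mem_nhds_iff.1 h1
    refine ⟨δ / 2, by positivity, hδ' ?_⟩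
    rw [Metric.mem_ball, Real.dist_eq, abs_sub_comm, abs_of_nonneg (by linarith)]
    linarith
  have hemp := tendstoInMeasure_average_halfSpaceIndicator hindep hident v (b - r)
  rw [tendstoInMeasure_iff_norm] at hemp hquad
  refine tendsto_measure_zero_mono (tendsto_measure_zero_union
    (hemp (η / 3) (by positivity)) (hquad (η / 3 * r ^ 2) (by positivity))) ?_
  filter_upwards [eventually_ge_atTop 1] with n hn ω hω
  have hω : sampleCDF n (Sig n ω) (fun j => w j ω) v b ≤ F b - η := hω
  by_contra hcon
  simp only [Set.mem_union, Set.mem_ofPred_eq, not_or, not_le, sub_zero, Real.norm_eq_abs] at hcon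
  have hq : 0 ≤ v ⬝ᵥ (Sig n ω *ᵥ v) := by
    simpa using (hSig n ω).dotProduct_mulVec_nonneg v
  have h1 := le_sampleCDF hn (fun j => w j ω) hq hr (show b - r + r ≤ b by linarith)
  have h2 : v ⬝ᵥ (Sig n ω *ᵥ v) / r ^ 2 < η / 3 := by
    rw [div_lt_iff₀ (by positivity)]
    exact (le_abs_self _).trans_lt hcon.2
  have h3 := (abs_lt.1 hcon.1).1
  linarith

/-- The approximate CDFs converge in probability at continuity points. -/
theorem tendstoInMeasure_sampleCDF
    (hindep : iIndepFun w μ) (hident : ∀ j, IdentDistrib (w j) wbar μ μ)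
    (hSig : ∀ Ns ω, (Sig Ns ω).PosSemidef) {v : ι → ℝ}
    (hquad : TendstoInMeasure μ (fun Ns ω => v ⬝ᵥ (Sig Ns ω *ᵥ v)) atTop (fun _ => 0))
    {b : ℝ} (hb : ContinuousAt (cdf (μ.map fun ω => v ⬝ᵥ wbar ω)) b) :
    TendstoInMeasure μ (fun Ns ω => sampleCDF Ns (Sig Ns ω) (fun j => w j ω) v b) atTop
      (fun _ => cdf (μ.map fun ω => v ⬝ᵥ wbar ω) b) := by
  rw [tendstoInMeasure_iff_norm]
  intro η hη
  obtain ⟨r, hr, hup⟩ :=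
    exists_tendsto_measure_cdf_add_le_sampleCDF hindep hident hSig hquad b hη
  refine tendsto_measure_zero_mono (tendsto_measure_zero_union hup
    (tendsto_measure_sampleCDF_le_cdf_sub hindep hident hSig hquad hb hη))
    (Eventually.of_forall fun n ω hω => ?_)
  simp only [Set.mem_ofPred_eq, Real.norm_eq_abs, le_abs] at hω
  rcases hω with hω | hω
  · exact Or.inl ⟨b, by linarith, by linarith⟩
  · refine Or.inr ?_
    simp only [Set.mem_ofPred_eq]
    linarith

end Samples

/-! ### Moments -/

section Moments

variable {ι : Type*} [Fintype ι] [DecidableEq ι]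

theorem sampleCF_single (Ns : ℕ) (Sig : Matrix ι ι ℝ) (w : ℕ → ι → ℝ) (k : ι) :
    (fun s : ℝ => sampleCF Ns Sig w (Pi.single k s)) = fun s : ℝ => ∑ j : Fin Ns,
      ((1 / (Ns : ℝ) : ℝ) : ℂ) * Complex.exp (Complex.I * w j k * s - Sig k k * s ^ 2 / 2) := by
  funext s
  rw [sampleCF, ecf]
  refine Finset.sum_congr rfl fun j _ => ?_
  rw [← Complex.exp_add, single_dotProduct, single_dotProduct]
  have : (Sig *ᵥ Pi.single k s) k = Sig k k * s := by simp [Matrix.mulVec_single]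
  rw [this]
  push_cast
  ring_nf

theorem hasDerivAt_cexp_quadratic (a c : ℂ) (s : ℝ) :
    HasDerivAt (fun s : ℝ => Complex.exp (Complex.I * a * s - c * s ^ 2 / 2))
      ((Complex.I * a - c * s) * Complex.exp (Complex.I * a * s - c * s ^ 2 / 2)) s := by
  have h : HasDerivAt (fun z : ℂ => Complex.exp (Complex.I * a * z - c * z ^ 2 / 2))
      ((Complex.I * a - c * s) * Complex.exp (Complex.I * a * s - c * s ^ 2 / 2)) (s : ℂ) := by
    have h1 : HasDerivAt (fun z : ℂ => Complex.I * a * z - c * z ^ 2 / 2)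
        (Complex.I * a - c * s) (s : ℂ) := by
      convert! ((hasDerivAt_id (s : ℂ)).const_mul (Complex.I * a)).sub
        ((((hasDerivAt_id (s : ℂ)).pow 2).const_mul c).div_const 2) using 1
      simp
      ring
    convert! h1.cexp using 1
    ring
  exact h.comp_ofReal

theorem hasDerivAt_linear_mul_cexp_quadratic (a c : ℂ) (s : ℝ) :
    HasDerivAt (fun s : ℝ => (Complex.I * a - c * s) *
        Complex.exp (Complex.I * a * s - c * s ^ 2 / 2))
      (-c * Complex.exp (Complex.I * a * s - c * s ^ 2 / 2) + (Complex.I * a - c * s) *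
        ((Complex.I * a - c * s) * Complex.exp (Complex.I * a * s - c * s ^ 2 / 2))) s := by
  have h : HasDerivAt (fun s : ℝ => Complex.I * a - c * (s : ℂ)) (-c) s := by
    simpa using (((hasDerivAt_id (s : ℂ)).const_mul c).const_sub (Complex.I * a)).comp_ofReal
  exact h.mul (hasDerivAt_cexp_quadratic a c s)

theorem deriv_sampleCF_single (Ns : ℕ) (Sig : Matrix ι ι ℝ) (w : ℕ → ι → ℝ) (k : ι) :
    deriv (fun s : ℝ => sampleCF Ns Sig w (Pi.single k s)) = fun s : ℝ => ∑ j : Fin Ns,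
      ((1 / (Ns : ℝ) : ℝ) : ℂ) * ((Complex.I * w j k - Sig k k * s) *
        Complex.exp (Complex.I * w j k * s - Sig k k * s ^ 2 / 2)) := by
  funext s
  rw [sampleCF_single]
  exact (HasDerivAt.fun_sum fun j _ => (hasDerivAt_cexp_quadratic _ _ s).const_mul _).deriv

/-- The damping factor has zero derivative at 0, so smoothing adds no bias to the mean. -/
theorem cfMoment_one_sampleCF (Ns : ℕ) (Sig : Matrix ι ι ℝ) (w : ℕ → ι → ℝ) (k : ι) :
    cfMoment (sampleCF Ns Sig w) 1 k =
      (((Ns : ℝ)⁻¹ • ∑ j ∈ Finset.range Ns, w j k ^ 1 : ℝ) : ℂ) := by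
  rw [cfMoment, iteratedDeriv_one, deriv_sampleCF_single, Finset.sum_range, smul_eq_mul,
    Finset.mul_sum, Finset.mul_sum]
  push_cast
  refine Finset.sum_congr rfl fun j _ => ?_
  simp
  linear_combination (-(Ns : ℂ)⁻¹ * w j k) * Complex.I_mul_I

/-- The damping factor has second derivative -Σ_kk at 0, and (-i)² flips the sign. With at least one
sample the weights sum to 1. -/
theorem cfMoment_two_sampleCF {Ns : ℕ} (hNs : 1 ≤ Ns) (Sig : Matrix ι ι ℝ) (w : ℕ → ι → ℝ)
    (k : ι) : cfMoment (sampleCF Ns Sig w) 2 k =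
      (((Ns : ℝ)⁻¹ • ∑ j ∈ Finset.range Ns, w j k ^ 2 + Sig k k : ℝ) : ℂ) := by
  rw [cfMoment, iteratedDeriv_succ, iteratedDeriv_one, deriv_sampleCF_single,
    (HasDerivAt.fun_sum fun (j : Fin Ns) _ =>
      (hasDerivAt_linear_mul_cexp_quadratic (w j k) (Sig k k) 0).const_mul _).deriv,
    ← average_add_const hNs, Finset.sum_range, smul_eq_mul, Finset.mul_sum, Finset.mul_sum]
  push_cast
  refine Finset.sum_congr rfl fun j _ => ?_
  simp
  ring_nf
  simp

variable {Ω : Type*} [MeasurableSpace Ω] {μ : Measure Ω}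
  {wbar : Ω → ι → ℝ} {w : ℕ → Ω → ι → ℝ} {Sig : ℕ → Ω → Matrix ι ι ℝ}

theorem tendstoInMeasure_ofReal_of_eventually_eq {f : ℕ → Ω → ℝ} {g : ℕ → Ω → ℂ} {c : ℝ}
    (hf : TendstoInMeasure μ f atTop fun _ => c)
    (hfg : ∀ᶠ n in atTop, ∀ ω, g n ω = ((f n ω : ℝ) : ℂ)) :
    TendstoInMeasure μ g atTop fun _ => (c : ℂ) := by
  rw [tendstoInMeasure_iff_norm] at hf ⊢
  intro ε hε
  refine tendsto_measure_zero_mono (hf ε hε) ?_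
  filter_upwards [hfg] with n hn ω hω
  simp only [Set.mem_ofPred_eq] at hω ⊢
  rwa [hn, ← Complex.ofReal_sub, Complex.norm_real] at hω

variable [IsProbabilityMeasure μ]

/-- The approximate first and second moments converge in probability. -/
theorem tendstoInMeasure_cfMoment_sampleCF
    (hindep : iIndepFun w μ) (hident : ∀ j, IdentDistrib (w j) wbar μ μ) (k : ι)
    (hquad : TendstoInMeasure μ (fun Ns ω => Pi.single k (1 : ℝ) ⬝ᵥ (Sig Ns ω *ᵥ Pi.single k 1))
      atTop (fun _ => 0))
    {d : ℕ} (hd : d ∈ ({1, 2} : Set ℕ)) (hint : Integrable (fun ω => wbar ω k ^ d) μ) :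
    TendstoInMeasure μ (fun Ns ω => cfMoment (sampleCF Ns (Sig Ns ω) (fun j => w j ω)) d k) atTop
      (fun _ => ((∫ ω, wbar ω k ^ d ∂μ : ℝ) : ℂ)) := by
  have hlln := tendstoInMeasure_average hindep hident (g := fun y => y k ^ d) (by fun_prop) hint
  rcases hd with rfl | rfl
  · exact tendstoInMeasure_ofReal_of_eventually_eq hlln (Eventually.of_forall fun n ω =>
      cfMoment_one_sampleCF _ _ _ _)
  · have h := tendstoInMeasure_add hlln hquad
    simp only [add_zero] at h
    refine tendstoInMeasure_ofReal_of_eventually_eq h ?_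
    filter_upwards [eventually_ge_atTop 1] with n hn ω
    rw [cfMoment_two_sampleCF hn]
    simp [Matrix.mulVec_single]

end Moments

/-! ### Feasibility -/

namespace ControlData

variable {n m p l N : ℕ} (D : ControlData n m p l N)

theorem state_mem_safeSet_iff (u : Fin N × Fin m → ℝ) (w : Fin N × Fin p → ℝ) :
    D.state u w ∈ D.safeSet ↔ ∀ i, D.row i ⬝ᵥ w ≤ D.margin i u := by
  refine forall_congr' fun i => ?_
  have : (D.P *ᵥ D.state u w) i =
      D.P i ⬝ᵥ (concatA N D.A *ᵥ D.x₀ + concatM N D.A D.B *ᵥ u) + D.row i ⬝ᵥ w := by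
    rw [row, ← Matrix.dotProduct_mulVec, ← dotProduct_add]
    rfl
  rw [this, margin, le_sub_iff_add_le']

theorem continuous_margin (i : Fin l) : Continuous (D.margin i) := by
  unfold margin Matrix.mulVec dotProduct
  simp only [Pi.add_apply]
  fun_prop

theorem inputSet_eq_Icc : D.inputSet = Set.Icc (fun c => D.uMin c.2) (fun c => D.uMax c.2) := by
  ext u
  simp only [inputSet, Set.mem_ofPred_eq, Set.mem_Icc, Pi.le_def, Prod.forall]
  exact forall_and

theorem isCompact_inputSet : IsCompact D.inputSet := D.inputSet_eq_Icc ▸ isCompact_Icc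

variable {Ω : Type*} [MeasurableSpace Ω] {μ : Measure Ω} [IsProbabilityMeasure μ]
  {wbar : Ω → Fin N × Fin p → ℝ}

/-- Boole's inequality reduces feasibility to the marginal distribution functions. -/
theorem mem_feasible_of_sum_le (hw : AEMeasurable wbar μ) {u : Fin N × Fin m → ℝ}
    (hu : u ∈ D.inputSet)
    (h : ∑ i, (1 - cdf (μ.map fun ω => D.row i ⬝ᵥ wbar ω) (D.margin i u)) ≤ D.Δ) :
    u ∈ D.feasible μ wbar := by
  refine ⟨?_, hu⟩
  have hsub : {ω | D.state u (wbar ω) ∉ D.safeSet} ⊆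
      ⋃ i, {ω | D.margin i u < D.row i ⬝ᵥ wbar ω} := by
    intro ω hω
    simpa [state_mem_safeSet_iff] using hω
  have hone : ∀ i, μ {ω | D.margin i u < D.row i ⬝ᵥ wbar ω} =
      ENNReal.ofReal (1 - cdf (μ.map fun ω => D.row i ⬝ᵥ wbar ω) (D.margin i u)) := by
    intro i
    have hv : AEMeasurable (fun ω => D.row i ⬝ᵥ wbar ω) μ :=
      (measurable_dotProduct_left (D.row i)).comp_aemeasurable hw
    have := Measure.isProbabilityMeasure_map hv
    rw [cdf_eq_real, ← probReal_compl_eq_one_sub measurableSet_Iic, ofReal_measureReal,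
      Set.compl_Iic, Measure.map_apply_of_aemeasurable hv measurableSet_Ioi]
    rfl
  calc μ {ω | D.state u (wbar ω) ∉ D.safeSet}
      ≤ ∑ i, μ {ω | D.margin i u < D.row i ⬝ᵥ wbar ω} :=
        (measure_mono hsub).trans (measure_iUnion_fintype_le _ _)
    _ = ENNReal.ofReal (∑ i, (1 - cdf (μ.map fun ω => D.row i ⬝ᵥ wbar ω) (D.margin i u))) := by
        rw [ENNReal.ofReal_sum_of_nonneg fun i _ => sub_nonneg.2 (cdf_le_one _ _)]
        exact Finset.sum_congr rfl fun i _ => hone i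
    _ ≤ ENNReal.ofReal D.Δ := ENNReal.ofReal_le_ofReal h

variable {D} in
/-- A pair that is feasible for the convex program bounds the risk allocation from below by the
under-approximated functions. -/
theorem one_sub_le_of_mem_convexFeasible {L : Fin l → PWA} {F : Fin l → ℝ → ℝ} {ε : ℝ}
    (hL : ∀ i, (L i).UnderApprox (F i) ε) {s : (Fin N × Fin m → ℝ) × (Fin l → ℝ)}
    (hs : s ∈ D.convexFeasible L) (i : Fin l) : 1 - s.2 i ≤ F i (D.margin i s.1) := by
  have h1 : 1 - s.2 i ≤ (L i).eval (D.margin i s.1) :=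
    Finset.le_inf' _ _ fun r _ => hs.1 i r
  have h2 := (hL i _ (hs.2.1 i)).1
  linarith

variable {w : ℕ → Ω → Fin N × Fin p → ℝ}
  {Sig : ℕ → Ω → Matrix (Fin N × Fin p) (Fin N × Fin p) ℝ} {ε : ℝ} {L : ℕ → Ω → Fin l → PWA}

/-- Around an input that is infeasible for the chance-constrained problem, feasibility for the
convex program has asymptotically vanishing probability. -/
theorem exists_nhds_tendsto_measure_convexFeasible
    (hindep : iIndepFun w μ) (hident : ∀ j, IdentDistrib (w j) wbar μ μ)
    (hSig : ∀ Ns ω, (Sig Ns ω).PosSemidef)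
    (hL : ∀ Ns, 1 ≤ Ns → ∀ ω i,
      (L Ns ω i).UnderApprox (sampleCDF Ns (Sig Ns ω) (fun j => w j ω) (D.row i)) ε)
    (hquad : ∀ v, TendstoInMeasure μ (fun Ns ω => v ⬝ᵥ (Sig Ns ω *ᵥ v)) atTop (fun _ => 0))
    {u : Fin N × Fin m → ℝ} (hu : u ∉ D.feasible μ wbar) :
    ∃ V ∈ 𝓝 u, Tendsto (fun Ns => μ {ω | ∃ s ∈ D.convexFeasible (L Ns ω), s.1 ∈ V})
      atTop (𝓝 0) := by
  by_cases hin : u ∈ D.inputSet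
  swap
  · refine ⟨D.inputSetᶜ, D.isCompact_inputSet.isClosed.isOpen_compl.mem_nhds hin, ?_⟩
    have : ∀ Ns, {ω | ∃ s ∈ D.convexFeasible (L Ns ω), s.1 ∈ D.inputSetᶜ} = ∅ := fun Ns =>
      Set.eq_empty_of_forall_notMem fun ω ⟨s, hs, hsV⟩ => hsV hs.2.2.2
    simp only [this, measure_empty, tendsto_const_nhds]
  have hgap := not_le.1 fun h => hu (D.mem_feasible_of_sum_le (hident 0).aemeasurable_snd hin h)
  set F : Fin l → ℝ := fun i => cdf (μ.map fun ω => D.row i ⬝ᵥ wbar ω) (D.margin i u) with hF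
  -- The l constraints together lose lη, strictly less than the gap (l + 1)η; the extra 1 also
  -- covers l = 0.
  set η : ℝ := (∑ i, (1 - F i) - D.Δ) / (l + 1) with hη
  have hηpos : 0 < η := div_pos (sub_pos.2 hgap) (by positivity)
  choose r hr hlim using fun i => exists_tendsto_measure_cdf_add_le_sampleCDF hindep hident hSig
    (hquad (D.row i)) (D.margin i u) hηpos
  -- The CDF bound is uniform on a left half line, so it also covers inputs chosen from the data.
  refine ⟨{u' | ∀ i, D.margin i u' < D.margin i u + r i}, ?_, ?_⟩
  · have : ∀ i, ∀ᶠ u' in 𝓝 u, D.margin i u' < D.margin i u + r i := fun i =>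
      (D.continuous_margin i).continuousAt.eventually_lt_const (by linarith [hr i])
    exact eventually_all.2 this
  · refine tendsto_measure_zero_mono (tendsto_measure_zero_iUnion hlim) ?_
    filter_upwards [eventually_ge_atTop 1] with Ns hNs ω hω
    obtain ⟨s, hs, hsV⟩ := hω
    by_contra hcon
    simp only [Set.mem_iUnion, Set.mem_ofPred_eq, not_exists, not_and, not_le] at hcon
    have hδ : ∀ i, 1 - F i - η ≤ s.2 i := by
      intro i
      have h1 := one_sub_le_of_mem_convexFeasible (hL Ns hNs ω) hs i
      have h2 := hcon i _ (hsV i).le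
      linarith
    have hsum := (Finset.sum_le_sum fun i (_ : i ∈ Finset.univ) => hδ i).trans hs.2.2.1.1
    rw [Finset.sum_sub_distrib, Finset.sum_const, Finset.card_univ, Fintype.card_fin,
      nsmul_eq_mul] at hsum
    have : η * (l + 1) = ∑ i, (1 - F i) - D.Δ := div_mul_cancel₀ _ (by positivity)
    linarith

end ControlData

theorem theorem2 {n m p l N : ℕ} (D : ControlData n m p l N) (hΔ : D.Δ ∈ Set.Icc (0 : ℝ) 1)
    {Ω : Type*} [MeasurableSpace Ω] (μ : Measure Ω) [IsProbabilityMeasure μ]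
    -- the disturbance and its i.i.d. samples
    (wbar : Ω → Fin N × Fin p → ℝ) (w : ℕ → Ω → Fin N × Fin p → ℝ)
    (hindep : iIndepFun w μ) (hident : ∀ j, IdentDistrib (w j) wbar μ μ)
    -- the smoothing matrices, which may depend on the sample size and on the data
    (Sig : ℕ → Ω → Matrix (Fin N × Fin p) (Fin N × Fin p) ℝ)
    (hSig : ∀ Ns ω, (Sig Ns ω).PosSemidef)
    -- the piecewise affine under-approximations of the approximate CDFs
    (ε : ℝ) (L : ℕ → Ω → Fin l → PWA)
    (hL : ∀ Ns, 1 ≤ Ns → ∀ ω i,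
      (L Ns ω i).UnderApprox (sampleCDF Ns (Sig Ns ω) (fun j => w j ω) (D.row i)) ε)
    -- the empirical characteristic function converges in probability
    (hconv : ∀ t : Fin N × Fin p → ℝ,
      TendstoInMeasure μ (fun Ns ω => sampleCF Ns (Sig Ns ω) (fun j => w j ω) t) atTop
        (fun _ => trueCF μ wbar t)) :
    -- the approximate CDFs converge in probability at continuity points of the true ones
    (∀ i, ∀ x, ContinuousAt (cdf (μ.map (fun ω => D.row i ⬝ᵥ wbar ω))) x →
      TendstoInMeasure μ
        (fun Ns ω => sampleCDF Ns (Sig Ns ω) (fun j => w j ω) (D.row i) x) atTop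
        (fun _ => cdf (μ.map (fun ω => D.row i ⬝ᵥ wbar ω)) x)) ∧
    -- the approximate first and second moments converge in probability to the true ones
    (∀ d ∈ ({1, 2} : Set ℕ), ∀ k, Integrable (fun ω => wbar ω k ^ d) μ →
      TendstoInMeasure μ
        (fun Ns ω => cfMoment (sampleCF Ns (Sig Ns ω) (fun j => w j ω)) d k) atTop
        (fun _ => ((∫ ω, wbar ω k ^ d ∂μ : ℝ) : ℂ))) ∧
    -- an input that is feasible for the convex program with non-vanishing probability is feasible
    (∀ u, ¬ Tendsto (fun Ns => μ {ω | ∃ δ, (u, δ) ∈ D.convexFeasible (L Ns ω)}) atTop (𝓝 0) →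
      u ∈ D.feasible μ wbar) ∧
    -- all feasible inputs of the convex program at once, including data-dependent ones
    (∀ η : ℝ, 0 < η → Tendsto (fun Ns => μ {ω | ¬ ∀ s ∈ D.convexFeasible (L Ns ω),
      s.1 ∈ Metric.thickening η (D.feasible μ wbar)}) atTop (𝓝 0)) := by
  have hquad := tendstoInMeasure_quadForm_zero hindep hident hSig hconv
  refine ⟨fun i x hx => tendstoInMeasure_sampleCDF hindep hident hSig (hquad _) hx,
    fun d hd k hint => tendstoInMeasure_cfMoment_sampleCF hindep hident k (hquad _) hd hint,
    fun u hu => ?_, fun η hη => ?_⟩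
  · by_contra hinf
    obtain ⟨V, hV, hlim⟩ := D.exists_nhds_tendsto_measure_convexFeasible hindep hident hSig hL
      hquad hinf
    refine hu (tendsto_measure_zero_mono hlim (Eventually.of_forall fun Ns ω hω => ?_))
    obtain ⟨δ, hδ⟩ := hω
    exact ⟨(u, δ), hδ, mem_of_mem_nhds hV⟩
  · have hK : IsCompact (D.inputSet \ Metric.thickening η (D.feasible μ wbar)) :=
      D.isCompact_inputSet.diff Metric.isOpen_thickening
    have hlim : Tendsto (fun Ns => μ {ω | ∃ s ∈ D.convexFeasible (L Ns ω),
        s.1 ∈ D.inputSet \ Metric.thickening η (D.feasible μ wbar)}) atTop (𝓝 0) := by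
      -- The sets of inputs hit with vanishing probability are closed under subsets and finite
      -- unions, so the local statement passes to compact sets.
      refine hK.induction_on (p := fun S => Tendsto
        (fun Ns => μ {ω | ∃ s ∈ D.convexFeasible (L Ns ω), s.1 ∈ S}) atTop (𝓝 0)) ?_ ?_ ?_ ?_
      · simp
      · exact fun S T hST hT => tendsto_measure_zero_mono hT
          (Eventually.of_forall fun Ns ω ⟨s, hs, hsS⟩ => ⟨s, hs, hST hsS⟩)
      · refine fun S T hS hT => tendsto_measure_zero_mono (tendsto_measure_zero_union hS hT)
          (Eventually.of_forall fun Ns ω ⟨s, hs, hsST⟩ => ?_)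
        exact hsST.imp (fun h => ⟨s, hs, h⟩) fun h => ⟨s, hs, h⟩
      · intro u hu
        obtain ⟨V, hV, hlim⟩ := D.exists_nhds_tendsto_measure_convexFeasible hindep hident hSig hL
          hquad fun hfeas => hu.2 (Metric.self_subset_thickening hη _ hfeas)
        exact ⟨V, mem_nhdsWithin_of_mem_nhds hV, hlim⟩
    refine tendsto_measure_zero_mono hlim (Eventually.of_forall fun Ns ω hω => ?_)
    simp only [Set.mem_ofPred_eq, not_forall] at hω
    obtain ⟨s, hs, hsη⟩ := hω
    exact ⟨s, hs, hs.2.2.2, hsη⟩
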